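/- A \emph{persistence diagram} $X$ consists of a countable subset $X_>$ of $\{(a,b)\in\mathbb R^2: a<b\}\times\mathbb N$ together with all of $\Delta\times\mathbb N$, where $\Delta=\{(a,a):a\in\mathbb R\}$; the $\mathbb N$-component is an index that allows multiplicities, and for points $x,y$ of diagrams $\|x-y\|_q$ denotes the $l^q$ distance of their components in $\mathbb R^2$. For $1\le p<\infty$ and $1\le q\le\infty$ let \[ d_p[l^q](X,Y)=\inf_{\varphi}\Big(\sum_{x\in X}\|x-\varphi(x)\|_q^p\Big)^{1/p}\in[0,\infty], \] the infimum being over all bijections $\varphi:X\to Y$; a bijection attaining it is called \emph{optimal}. Let $\mathcal D_p[l^q]$ be the set of diagrams $X$ with $d_p[l^q](X,\emptyset)<\infty$, where $\emptyset$ is the diagram with no points off the diagonal. A \emph{geodesic} from $X$ to $Y$ in $\mathcal D_p[l^q]$ is a continuous map $\mu:[0,1]\to\mathcal D_p[l^q]$ with $\mu(0)=X$, $\mu(1)=Y$ and $d_p[l^q](\mu(s),\mu(t))=|t-s|\,d_p[l^q](\mu(0),\mu(1))$ for all $s,t\in[0,1]$. It is a \emph{convex-combination geodesic} if there is an optimal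 bijection $\varphi:X\to Y$ such that, for every $t\in[0,1)$, the off-diagonal points of $\mu(t)$ are exactly the off-diagonal points among $\big((1-t)\pi(x)+t\,\pi(\varphi(x)),\,n(x)\big)$, $x\in X$, where $\pi(x)\in\mathbb R^2$ and $n(x)\in\mathbb N$ are the components of $x$ (and $\mu(1)=Y$). \textbf{Theorem.} Let either $p=q\in[2,\infty)$, or $q=2$ and $p\in(1,\infty)$. Let $X,Y\in\mathcal D_p[l^q]$ (possibly with infinitely many off-diagonal points), and let $\mu:[0,1]\to\mathcal D_p[l^q]$ be a geodesic from $X$ to $Y$. Then there is a convex-combination geodesic $\gamma:[0,1]\to\mathcal D_p[l^q]$ from $X$ to $Y$ such that $d_p[l^q](\gamma(t),\mu(t))=0$ for every $t\in[0,1]$. -/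

import Mathlib

open scoped ENNReal Topology unitInterval

noncomputable section

/-- A persistence diagram: a countable set of points of the plane strictly above the diagonal, each
carrying a natural number as an index (so that a point of the plane can occur with multiplicity),
together with countably many copies of the diagonal. The copies of the diagonal are the same for
all diagrams, so only the part above the diagonal is recorded; see `carrier` for all points. -/
@[ext]
structure PersistenceDiagram where
  /-- the points above the diagonal, with their indices -/
  offDiag : Set ((ℝ × ℝ) × ℕ)
  countable_offDiag : offDiag.Countable
  above : ∀ z ∈ offDiag, z.1.1 < z.1.2

namespace PersistenceDiagram

/-- All the points of a diagram: the points above the diagonal and the diagonal, the latter with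
one copy for each natural number. -/
def carrier (X : PersistenceDiagram) : Set ((ℝ × ℝ) × ℕ) :=
  X.offDiag ∪ {z | z.1.1 = z.1.2}

/-- The empty diagram: only the diagonal, with countably infinite multiplicity. -/
def empty : PersistenceDiagram where
  offDiag := ∅
  countable_offDiag := Set.countable_empty
  above := fun _ hz => hz.elim

/-- The `l^q` distance `‖a - b‖_q` between two points of the plane, as an element of `[0, ∞]`. -/
def groundDist (q : ℝ≥0∞) (a b : ℝ × ℝ) : ℝ≥0∞ :=
  ENNReal.ofReal ‖WithLp.toLp q (a - b)‖

/-- The `l^p[l^q]` matching cost of a bijection between two diagrams. Only the planar component of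
a point enters. The sum runs over all points, those on the diagonal included; it is an
unconditional sum in `[0, ∞]`. -/
def cost (p q : ℝ≥0∞) {X Y : PersistenceDiagram} (φ : X.carrier ≃ Y.carrier) : ℝ≥0∞ :=
  if p = ∞ then ⨆ x : X.carrier, groundDist q x.1.1 (φ x).1.1
  else (∑' x : X.carrier, groundDist q x.1.1 (φ x).1.1 ^ p.toReal) ^ (1 / p.toReal)

/-- The matching distance `d_p[l^q]`, with values in `[0, ∞]`. -/
def matchingDist (p q : ℝ≥0∞) (X Y : PersistenceDiagram) : ℝ≥0∞ :=
  ⨅ φ : X.carrier ≃ Y.carrier, cost p q φ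

/-- A bijection is optimal when it attains the infimum that defines the matching distance. -/
def IsOptimal (p q : ℝ≥0∞) {X Y : PersistenceDiagram} (φ : X.carrier ≃ Y.carrier) : Prop :=
  cost p q φ = matchingDist p q X Y

/-- The space `D_p[l^q]` of diagrams at finite distance from the empty diagram. -/
def Dgm (p q : ℝ≥0∞) : Set PersistenceDiagram :=
  {X | matchingDist p q X empty < ∞}

/-- A geodesic of `D_p[l^q]` from `X` to `Y`: a continuous map on `[0,1]` with end points `X`
and `Y` such that `d (μ s) (μ t) = |t - s| d (μ 0) (μ 1)`. -/
structure IsGeodesic (p q : ℝ≥0∞) (X Y : PersistenceDiagram) (μ : I → Dgm p q) : Prop where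
  source : (μ 0 : PersistenceDiagram) = X
  target : (μ 1 : PersistenceDiagram) = Y
  continuous : ∀ t : I,
    Filter.Tendsto (fun s : I => matchingDist p q (μ s) (μ t)) (𝓝 t) (𝓝 0)
  dist_eq : ∀ s t : I, matchingDist p q (μ s) (μ t) =
    ENNReal.ofReal |(t : ℝ) - (s : ℝ)| * matchingDist p q (μ 0) (μ 1)

/-- The points `((1 - t) x + t φ(x), index of x)`, for `x` in `X`, that lie above the diagonal. -/
def interpolant {X Y : PersistenceDiagram} (φ : X.carrier ≃ Y.carrier) (t : ℝ) :
    Set ((ℝ × ℝ) × ℕ) :=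
  {z | z.1.1 < z.1.2 ∧
    ∃ x : X.carrier, z = ((1 - t) • x.1.1 + t • (φ x).1.1, x.1.2)}

theorem countable_interpolant {X Y : PersistenceDiagram} (φ : X.carrier ≃ Y.carrier) (t : ℝ) :
    (interpolant φ t).Countable := by
  have h1 : {x : X.carrier | x.1 ∈ X.offDiag}.Countable :=
    X.countable_offDiag.preimage Subtype.val_injective
  have h2 : {x : X.carrier | (φ x).1 ∈ Y.offDiag}.Countable :=
    Y.countable_offDiag.preimage (Subtype.val_injective.comp φ.injective)
  refine ((h1.union h2).image
    (fun x : X.carrier => ((1 - t) • x.1.1 + t • (φ x).1.1, x.1.2))).mono ?_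
  rintro z ⟨hz, x, rfl⟩
  refine ⟨x, ?_, rfl⟩
  by_contra hx
  rw [Set.mem_union, not_or] at hx
  have e1 : x.1.1.1 = x.1.1.2 := x.2.resolve_left hx.1
  have e2 : (φ x).1.1.1 = (φ x).1.1.2 := (φ x).2.resolve_left hx.2
  simp [e1, e2] at hz

/-- The convex combination of `X` and `Y` along `φ` at time `t`. Before time `1` a point keeps the
index that it has in `X`; at time `1` the diagram is `Y` itself. As for every diagram, the
points on the diagonal are all those of the plane's diagonal, each with every index. -/
def convexCombination {X Y : PersistenceDiagram} (φ : X.carrier ≃ Y.carrier) (t : I) :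
    PersistenceDiagram :=
  if t = 1 then Y
  else
    { offDiag := interpolant φ t
      countable_offDiag := countable_interpolant φ t
      above := fun _ hz => hz.1 }

/-- A convex-combination geodesic from `X` to `Y`: a geodesic that is the convex combination along
some optimal bijection. -/
def IsConvexCombinationGeodesic (p q : ℝ≥0∞) (X Y : PersistenceDiagram) (γ : I → Dgm p q) : Prop :=
  IsGeodesic p q X Y γ ∧
    ∃ φ : X.carrier ≃ Y.carrier, IsOptimal p q φ ∧
      ∀ t : I, (γ t : PersistenceDiagram) = convexCombination φ t

end PersistenceDiagram

end

namespace PersistenceDiagram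

/-! ### The ground distance -/

section GroundDist

variable (q : ℝ≥0∞)

/-! Everything rests on the strict convexity of `v ↦ ‖v‖_q ^ p` on the plane. If `w` is visited at
time `s` on the way from `x` to `y`, then `‖x - y‖^p ≤ s^(1-p) ‖x - w‖^p + (1-s)^(1-p) ‖w - y‖^p`,
with equality only for `w = (1-s)x + sy`. Sum this over a composition of bijections whose legs cost
at most `sD` and `(1-s)D`, where `D = d(X,Y)`: the right side is at most `D^p`, so every point must
lie on its segment (`eq_segment_of_cost_le`).

Fix optimal bijections `ψ` from `X` to `μ(1/2)` and `χ` from `μ(1/2)` to `Y`; their composition `φ`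
is optimal. For any other time `t`, insert `μ(t)` by optimal bijections. These need not be
compatible with `φ`, but rigidity at time `1/2` shows that a segment is determined by its midpoint
and one end, up to the choice of indices. Hence `μ(t)` consists of the points of the segments of `φ`
at time `t`. One intermediate time suffices; no limit over subdivisions is taken.

Two further facts are needed. Optimal bijections exist even for infinite diagrams, by an ultrafilter
limit (`exists_isOptimal`). Segments of an optimal bijection from distinct planar points do not meet
at interior times, by exchanging ends (`IsOptimal.eq_of_segment_eq`), so the indices of `X` still
separate the points of the convex combination. Indices in `μ(t)` are arbitrary, so diagrams are
compared through planar enumerations (`Param`) and the conclusion is distance zero, not equality. -/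

theorem groundDist_self [Fact (1 ≤ q)] (a : ℝ × ℝ) : groundDist q a a = 0 := by
  simp [groundDist]

theorem groundDist_comm [Fact (1 ≤ q)] (a b : ℝ × ℝ) : groundDist q a b = groundDist q b a := by
  rw [groundDist, groundDist, ← neg_sub b a, WithLp.toLp_neg, norm_neg]

theorem groundDist_ne_top (a b : ℝ × ℝ) : groundDist q a b ≠ ∞ := ENNReal.ofReal_ne_top

theorem groundDist_triangle [Fact (1 ≤ q)] (a b c : ℝ × ℝ) :
    groundDist q a c ≤ groundDist q a b + groundDist q b c := by
  rw [groundDist, groundDist, groundDist, ← ENNReal.ofReal_add (norm_nonneg _) (norm_nonneg _)]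
  refine ENNReal.ofReal_le_ofReal ?_
  rw [← sub_add_sub_cancel a b c, WithLp.toLp_add]
  exact norm_add_le _ _

theorem groundDist_rpow [Fact (1 ≤ q)] {r : ℝ} (hr : 0 ≤ r) (a b : ℝ × ℝ) :
    groundDist q a b ^ r = ENNReal.ofReal (‖WithLp.toLp q (a - b)‖ ^ r) :=
  ENNReal.ofReal_rpow_of_nonneg (norm_nonneg _) hr

/-- The projection of the plane to the diagonal along the antidiagonal. -/
noncomputable def diagProj (a : ℝ × ℝ) : ℝ × ℝ := ((a.1 + a.2) / 2, (a.1 + a.2) / 2)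

theorem norm_toLp_swap [Fact (1 ≤ q)] (v : ℝ × ℝ) :
    ‖WithLp.toLp q v.swap‖ = ‖WithLp.toLp q v‖ := by
  rcases eq_or_ne q ∞ with rfl | hq
  · simp [WithLp.prod_norm_eq_sup, max_comm]
  · have h0 : 0 < q.toReal := ENNReal.toReal_pos (zero_lt_one.trans_le (Fact.out : 1 ≤ q)).ne' hq
    rw [WithLp.prod_norm_eq_add h0, WithLp.prod_norm_eq_add h0]
    simp [add_comm]

/-- The swap of coordinates is an isometry fixing `b`, and `a - diagProj a` is half the difference
of `a - b` and its swap. The same projection is therefore nearest for every `q`. -/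
theorem groundDist_diagProj_le [Fact (1 ≤ q)] (a : ℝ × ℝ) {b : ℝ × ℝ} (hb : b.1 = b.2) :
    groundDist q a (diagProj a) ≤ groundDist q a b := by
  refine ENNReal.ofReal_le_ofReal ?_
  have e : a - diagProj a = (1 / 2 : ℝ) • ((a - b) - (a - b).swap) := by
    ext <;> simp [diagProj, hb] <;> ring
  rw [e, WithLp.toLp_smul, WithLp.toLp_sub, norm_smul]
  have h1 := norm_sub_le (WithLp.toLp q (a - b)) (WithLp.toLp q (a - b).swap)
  rw [norm_toLp_swap] at h1
  rw [Real.norm_of_nonneg (by norm_num)]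
  linarith

end GroundDist

/-! ### Strict convexity of the powers of the norms of the plane -/

/-- For equal norms, strictness comes from the round unit ball; for different norms, from the strict
convexity of the power function. -/
theorem strictConvexOn_norm_rpow {E : Type*} [NormedAddCommGroup E] [NormedSpace ℝ E]
    [StrictConvexSpace ℝ E] {r : ℝ} (hr : 1 < r) :
    StrictConvexOn ℝ Set.univ (fun v : E => ‖v‖ ^ r) := by
  have hr0 : 0 < r := zero_lt_one.trans hr
  refine ⟨convex_univ, fun u _ v _ huv a b ha hb hab => ?_⟩
  simp only [smul_eq_mul]
  rcases eq_or_ne ‖u‖ ‖v‖ with h | h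
  · have h1 : ‖a • u + b • v‖ < ‖u‖ := norm_combo_lt_of_ne le_rfl h.ge huv ha hb hab
    calc ‖a • u + b • v‖ ^ r < ‖u‖ ^ r := Real.rpow_lt_rpow (norm_nonneg _) h1 hr0
      _ = a * ‖u‖ ^ r + b * ‖v‖ ^ r := by rw [← h, ← add_mul, hab, one_mul]
  · refine lt_of_le_of_lt ?_
      ((strictConvexOn_rpow hr).2 (norm_nonneg u) (norm_nonneg v) h ha hb hab)
    refine Real.rpow_le_rpow (norm_nonneg _) ((norm_add_le _ _).trans_eq ?_) hr0.le
    rw [norm_smul, norm_smul, Real.norm_of_nonneg ha.le, Real.norm_of_nonneg hb.le]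
    rfl

theorem strictConvexOn_norm_toLp_two {r : ℝ} (hr : 1 < r) :
    StrictConvexOn ℝ Set.univ (fun v : ℝ × ℝ => ‖WithLp.toLp 2 v‖ ^ r) := by
  refine ⟨convex_univ, fun u _ v _ huv a b ha hb hab => ?_⟩
  have := (strictConvexOn_norm_rpow (E := WithLp 2 (ℝ × ℝ)) hr).2 (Set.mem_univ (WithLp.toLp 2 u))
    (Set.mem_univ (WithLp.toLp 2 v)) (fun h => huv (WithLp.toLp_injective 2 h)) ha hb hab
  simpa only [← WithLp.toLp_smul, ← WithLp.toLp_add] using this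

/-- With matching exponents the power splits into one convex term per coordinate, and two distinct
vectors differ in some coordinate. -/
theorem strictConvexOn_norm_toLp_self {p : ℝ≥0∞} (hp : 1 < p.toReal) :
    StrictConvexOn ℝ Set.univ (fun v : ℝ × ℝ => ‖WithLp.toLp p v‖ ^ p.toReal) := by
  have h0 : 0 < p.toReal := zero_lt_one.trans hp
  have key : ∀ v : ℝ × ℝ, ‖WithLp.toLp p v‖ ^ p.toReal = ‖v.1‖ ^ p.toReal + ‖v.2‖ ^ p.toReal := by
    intro v
    rw [WithLp.prod_norm_eq_add h0, ← Real.rpow_mul (by positivity), one_div,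
      inv_mul_cancel₀ h0.ne', Real.rpow_one]
    rfl
  simp only [key]
  have hs := strictConvexOn_norm_rpow (E := ℝ) hp
  refine ⟨convex_univ, fun u _ v _ huv a b ha hb hab => ?_⟩
  have c1 := hs.convexOn.2 (Set.mem_univ u.1) (Set.mem_univ v.1) ha.le hb.le hab
  have c2 := hs.convexOn.2 (Set.mem_univ u.2) (Set.mem_univ v.2) ha.le hb.le hab
  simp only [smul_eq_mul, Prod.fst_add, Prod.snd_add, Prod.smul_fst, Prod.smul_snd] at *
  by_cases h1 : u.1 = v.1
  · have h2 : u.2 ≠ v.2 := fun h2 => huv (Prod.ext h1 h2)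
    have c3 := hs.2 (Set.mem_univ u.2) (Set.mem_univ v.2) h2 ha hb hab
    simp only [smul_eq_mul] at c3
    linarith
  · have c3 := hs.2 (Set.mem_univ u.1) (Set.mem_univ v.1) h1 ha hb hab
    simp only [smul_eq_mul] at c3
    linarith

section StrictConvex

variable {q : ℝ≥0∞} [Fact (1 ≤ q)] {r : ℝ}

theorem norm_toLp_smul_rpow {c : ℝ} (hc : 0 < c) (v : ℝ × ℝ) :
    ‖WithLp.toLp q (c • v)‖ ^ r = c ^ r * ‖WithLp.toLp q v‖ ^ r := by
  rw [WithLp.toLp_smul, norm_smul, Real.norm_of_nonneg hc.le,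
    Real.mul_rpow hc.le (norm_nonneg _)]

/-- The vector `x - y` is the combination, with weights `s` and `1 - s`, of the velocities `s⁻¹(x -
w)` and `(1-s)⁻¹(w - y)` of the two legs. -/
theorem groundDist_rpow_le_of_convexOn (hr : 0 ≤ r)
    (hc : ConvexOn ℝ Set.univ (fun v : ℝ × ℝ => ‖WithLp.toLp q v‖ ^ r))
    {s : ℝ} (h0 : 0 < s) (h1 : s < 1) (x w y : ℝ × ℝ) :
    groundDist q x y ^ r ≤ ENNReal.ofReal (s * s⁻¹ ^ r) * groundDist q x w ^ r
      + ENNReal.ofReal ((1 - s) * (1 - s)⁻¹ ^ r) * groundDist q w y ^ r := by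
  have h1' : 0 < 1 - s := sub_pos.2 h1
  rw [groundDist_rpow q hr, groundDist_rpow q hr, groundDist_rpow q hr,
    ← ENNReal.ofReal_mul (by positivity), ← ENNReal.ofReal_mul (by positivity),
    ← ENNReal.ofReal_add (by positivity) (by positivity)]
  refine ENNReal.ofReal_le_ofReal ?_
  have := hc.2 (Set.mem_univ (s⁻¹ • (x - w))) (Set.mem_univ ((1 - s)⁻¹ • (w - y))) h0.le h1'.le
    (by ring)
  simp only [smul_smul, mul_inv_cancel₀ h0.ne', mul_inv_cancel₀ h1'.ne', one_smul,
    sub_add_sub_cancel, norm_toLp_smul_rpow (inv_pos.2 h0), norm_toLp_smul_rpow (inv_pos.2 h1'),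
    smul_eq_mul] at this
  linarith

theorem groundDist_rpow_lt_of_strictConvexOn (hr : 0 ≤ r)
    (hc : StrictConvexOn ℝ Set.univ (fun v : ℝ × ℝ => ‖WithLp.toLp q v‖ ^ r))
    {s : ℝ} (h0 : 0 < s) (h1 : s < 1) {x w y : ℝ × ℝ} (hw : w ≠ (1 - s) • x + s • y) :
    groundDist q x y ^ r < ENNReal.ofReal (s * s⁻¹ ^ r) * groundDist q x w ^ r
      + ENNReal.ofReal ((1 - s) * (1 - s)⁻¹ ^ r) * groundDist q w y ^ r := by
  have h1' : 0 < 1 - s := sub_pos.2 h1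
  rw [groundDist_rpow q hr, groundDist_rpow q hr, groundDist_rpow q hr,
    ← ENNReal.ofReal_mul (by positivity), ← ENNReal.ofReal_mul (by positivity),
    ← ENNReal.ofReal_add (by positivity) (by positivity)]
  -- Equal velocities on the two legs would place `w` on the segment at time `s`.
  have hne : s⁻¹ • (x - w) ≠ (1 - s)⁻¹ • (w - y) := by
    intro h
    have h2 := congrArg (fun v => (s * (1 - s)) • v) h
    simp only [smul_smul] at h2
    rw [show s * (1 - s) * s⁻¹ = 1 - s by field_simp,
      show s * (1 - s) * (1 - s)⁻¹ = s by field_simp] at h2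
    refine hw ?_
    rw [← sub_eq_zero] at h2 ⊢
    rw [← neg_eq_zero, ← h2]
    module
  have := hc.2 (Set.mem_univ (s⁻¹ • (x - w))) (Set.mem_univ ((1 - s)⁻¹ • (w - y))) hne h0 h1'
    (by ring)
  simp only [smul_smul, mul_inv_cancel₀ h0.ne', mul_inv_cancel₀ h1'.ne', one_smul,
    sub_add_sub_cancel, norm_toLp_smul_rpow (inv_pos.2 h0), norm_toLp_smul_rpow (inv_pos.2 h1'),
    smul_eq_mul] at this
  have key : ‖WithLp.toLp q (x - y)‖ ^ r < s * s⁻¹ ^ r * ‖WithLp.toLp q (x - w)‖ ^ r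
      + (1 - s) * (1 - s)⁻¹ ^ r * ‖WithLp.toLp q (w - y)‖ ^ r := by linarith
  exact (ENNReal.ofReal_lt_ofReal_iff (lt_of_le_of_lt (by positivity) key)).2 key

/-- Two distinct segments that meet at the same interior time become cheaper when their end points
are exchanged. -/
theorem groundDist_rpow_swap_lt (hr : 0 ≤ r)
    (hc : StrictConvexOn ℝ Set.univ (fun v : ℝ × ℝ => ‖WithLp.toLp q v‖ ^ r))
    {t : ℝ} (h0 : 0 < t) (h1 : t < 1) {x y x' y' : ℝ × ℝ} (hx : x ≠ x')
    (h : (1 - t) • x + t • y = (1 - t) • x' + t • y') :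
    groundDist q x y' ^ r + groundDist q x' y ^ r < groundDist q x y ^ r + groundDist q x' y' ^ r := by
  have h1' : 0 < 1 - t := sub_pos.2 h1
  simp only [groundDist_rpow q hr]
  rw [← ENNReal.ofReal_add (by positivity) (by positivity),
    ← ENNReal.ofReal_add (by positivity) (by positivity)]
  have hne : x - y ≠ x' - y' := by
    intro hv
    refine hx ?_
    rw [← sub_eq_zero] at h hv ⊢
    rw [show x - x' = ((1 - t) • x + t • y - ((1 - t) • x' + t • y'))
      + t • (x - y - (x' - y')) by module, h, hv]
    simp
  -- After the exchange, the displacements are complementary averages of the old ones, so the two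
  -- convexity bounds add up to the old total.
  have e1 : x - y' = t • (x - y) + (1 - t) • (x' - y') := by
    rw [← sub_eq_zero] at h ⊢
    rw [← h]; module
  have e2 : x' - y = (1 - t) • (x - y) + t • (x' - y') := by
    rw [← sub_eq_zero] at h ⊢
    rw [← neg_eq_zero, ← h]; module
  have c1 := hc.2 (Set.mem_univ (x - y)) (Set.mem_univ (x' - y')) hne h0 h1' (by ring)
  have c2 := hc.2 (Set.mem_univ (x - y)) (Set.mem_univ (x' - y')) hne h1' h0 (by ring)
  simp only [← e1, ← e2, smul_eq_mul] at c1 c2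
  have key : ‖WithLp.toLp q (x - y')‖ ^ r + ‖WithLp.toLp q (x' - y)‖ ^ r <
      ‖WithLp.toLp q (x - y)‖ ^ r + ‖WithLp.toLp q (x' - y')‖ ^ r := by linarith
  exact (ENNReal.ofReal_lt_ofReal_iff (lt_of_le_of_lt (by positivity) key)).2 key

end StrictConvex

/-! ### Parametrizations of diagrams -/

/-- The planar family `f` enumerates the points of `A`, the diagonal included, with their
multiplicities. -/
def Param (A : PersistenceDiagram) {S : Type} (f : S → ℝ × ℝ) : Prop :=
  ∃ e : S ≃ A.carrier, ∀ s, (e s).1.1 = f s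

/-- The enumeration of the diagonal with countably infinite multiplicity. -/
def diagCopies (z : ℝ × ℕ) : ℝ × ℝ := (z.1, z.1)

theorem param_carrier (A : PersistenceDiagram) : Param A (fun x : A.carrier => x.1.1) :=
  ⟨Equiv.refl _, fun _ => rfl⟩

theorem param_equiv {A B : PersistenceDiagram} (φ : A.carrier ≃ B.carrier) :
    Param B (fun x : A.carrier => (φ x).1.1) :=
  ⟨φ, fun _ => rfl⟩

theorem Param.comp {A : PersistenceDiagram} {S T : Type} {f : S → ℝ × ℝ} (h : Param A f)
    (e : T ≃ S) : Param A (fun t => f (e t)) :=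
  let ⟨e', he'⟩ := h
  ⟨e.trans e', fun t => he' (e t)⟩

theorem param_of_fibers {A : PersistenceDiagram} {S : Type} {f : S → ℝ × ℝ}
    (h : ∀ v, Nonempty ({s // f s = v} ≃ {z : A.carrier // z.1.1 = v})) : Param A f :=
  ⟨Equiv.ofFiberEquiv (f := f) (g := fun z : A.carrier => z.1.1) fun v => (h v).some,
    fun s => Equiv.ofFiberEquiv_map (g := fun z : A.carrier => z.1.1) _ s⟩

theorem carrier_le {A : PersistenceDiagram} (z : A.carrier) : z.1.1.1 ≤ z.1.1.2 :=
  z.2.elim (fun h => (A.above _ h).le) le_of_eq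

theorem mem_offDiag_of_lt {A : PersistenceDiagram} {z : (ℝ × ℝ) × ℕ} (hz : z ∈ A.carrier)
    (h : z.1.1 < z.1.2) : z ∈ A.offDiag :=
  hz.resolve_right fun h' => h.ne h'

theorem countable_setOf_carrier_eq (A : PersistenceDiagram) (v : ℝ × ℝ) :
    {z : A.carrier | z.1.1 = v}.Countable :=
  Set.countable_of_injective_of_countable_image (f := fun z : A.carrier => z.1.2)
    (fun _ hz _ hw h => Subtype.ext (Prod.ext (Eq.trans hz (Eq.symm hw)) h)) (Set.to_countable _)

/-- A family that enumerates the off-diagonal points of `A` without repetition and is elsewhere on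
the diagonal becomes a parametrization of `A` once the diagonal is added, as long as it visits each
diagonal point countably often. -/
theorem param_sum {A : PersistenceDiagram} {S : Type} {k : S → (ℝ × ℝ) × ℕ}
    (hle : ∀ s, (k s).1.1 ≤ (k s).1.2)
    (hinj : ∀ s s', (k s).1.1 < (k s).1.2 → k s = k s' → s = s')
    (hmem : ∀ s, (k s).1.1 < (k s).1.2 → k s ∈ A.offDiag)
    (hsurj : ∀ z ∈ A.offDiag, ∃ s, k s = z)
    (hcount : ∀ a : ℝ, {s | (k s).1 = (a, a)}.Countable) :
    Param A (Sum.elim (fun s => (k s).1) diagCopies) := by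
  refine param_of_fibers fun v => ?_
  rcases lt_trichotomy v.1 v.2 with hv | hv | hv
  · have hlt : ∀ u : {u // Sum.elim (fun s => (k s).1) diagCopies u = v},
        ∃ s, u.1 = Sum.inl s ∧ (k s).1 = v := by
      rintro ⟨s | z, hs⟩
      · exact ⟨s, rfl, hs⟩
      · rw [← hs] at hv
        exact absurd hv (lt_irrefl _)
    choose s hs hsv using hlt
    refine ⟨Equiv.ofBijective (fun u => ⟨⟨k (s u), Or.inl (hmem _ (by rw [hsv]; exact hv))⟩,
      hsv u⟩) ⟨fun u w h => ?_, fun ⟨⟨z, hz⟩, hzv⟩ => ?_⟩⟩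
    · have h1 : k (s u) = k (s w) := congrArg (fun x => x.1.1) h
      have h2 := hinj _ _ (by rw [hsv]; exact hv) h1
      exact Subtype.ext (by rw [hs u, hs w, h2])
    · dsimp only at hzv
      obtain ⟨s', hs'⟩ := hsurj z (mem_offDiag_of_lt hz (by rw [hzv]; exact hv))
      refine ⟨⟨Sum.inl s', by simp [hs', hzv]⟩, ?_⟩
      have h1 := hs ⟨Sum.inl s', by simp [hs', hzv]⟩
      refine Subtype.ext (Subtype.ext ?_)
      dsimp only at h1 ⊢
      rw [← Sum.inl_injective h1, hs']
  -- Over a diagonal point both fibers are countably infinite, so any bijection will do.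
  · obtain ⟨a, b⟩ := v
    obtain rfl : a = b := hv
    have i1 : Countable {u // Sum.elim (fun s => (k s).1) diagCopies u = (a, a)} := by
      refine Set.Countable.to_subtype (s := {u | Sum.elim (fun s => (k s).1) diagCopies u = (a, a)})
        ((((hcount a).image Sum.inl).union
          (Set.countable_range (fun n : ℕ => Sum.inr (a, n)))).mono ?_)
      rintro (s | ⟨b, n⟩) hu
      · exact Or.inl ⟨s, hu, rfl⟩
      · obtain rfl : b = a := congrArg Prod.fst hu
        exact Or.inr ⟨n, rfl⟩
    have i2 : Infinite {u // Sum.elim (fun s => (k s).1) diagCopies u = (a, a)} :=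
      Infinite.of_injective (fun n : ℕ => ⟨Sum.inr (a, n), rfl⟩) fun m n h =>
        congrArg Prod.snd (Sum.inr_injective (congrArg Subtype.val h))
    have i3 : Countable {z : A.carrier // z.1.1 = (a, a)} :=
      Function.Injective.countable (f := fun z => z.1.1.2) fun z w h =>
        Subtype.ext (Subtype.ext (Prod.ext (z.2.trans w.2.symm) h))
    have i4 : Infinite {z : A.carrier // z.1.1 = (a, a)} :=
      Infinite.of_injective (fun n : ℕ => ⟨⟨((a, a), n), Or.inr rfl⟩, rfl⟩)
        fun m n h => congrArg (fun z => z.1.1.2) h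
    exact nonempty_equiv_of_countable
  · have i1 : IsEmpty {u // Sum.elim (fun s => (k s).1) diagCopies u = v} := by
      refine ⟨?_⟩
      rintro ⟨s | z, rfl⟩
      · exact (hle s).not_gt hv
      · exact lt_irrefl _ hv
    have i2 : IsEmpty {z : A.carrier // z.1.1 = v} :=
      ⟨fun z => (carrier_le z.1).not_gt (by rw [z.2]; exact hv)⟩
    exact ⟨Equiv.equivOfIsEmpty _ _⟩

/-- Adding more copies of the diagonal does not change a diagram. -/
theorem Param.sum_diagCopies {A : PersistenceDiagram} {S : Type} {f : S → ℝ × ℝ}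
    (h : Param A f) : Param A (Sum.elim f diagCopies) := by
  have h1 : Param A (Sum.elim (fun x : A.carrier => x.1.1) diagCopies) := by
    refine param_sum (k := fun x : A.carrier => x.1) (fun z => carrier_le z)
      (fun _ _ _ h => Subtype.ext h) (fun z hz => mem_offDiag_of_lt z.2 hz)
      (fun z hz => ⟨⟨z, Or.inl hz⟩, rfl⟩) (fun a => countable_setOf_carrier_eq A (a, a))
  obtain ⟨e, he⟩ := h
  convert h1.comp (Equiv.sumCongr e (Equiv.refl _)) using 1
  funext u
  rcases u with s | z
  · exact (he s).symm
  · rfl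

/-! ### The matching distance in terms of parametrizations -/

/-- The `p`-th power of the matching cost of two planar families. -/
noncomputable def transportCost (p q : ℝ≥0∞) {S : Type} (f g : S → ℝ × ℝ) : ℝ≥0∞ :=
  ∑' s, groundDist q (f s) (g s) ^ p.toReal

section Distance

variable {p q : ℝ≥0∞} {X Y Z : PersistenceDiagram}

theorem cost_eq (hp : p ≠ ∞) (φ : X.carrier ≃ Y.carrier) :
    cost p q φ =
      transportCost p q (fun x : X.carrier => x.1.1) (fun x => (φ x).1.1) ^ (1 / p.toReal) :=
  if_neg hp

theorem Param.exists_cost_eq {S : Type} {f g : S → ℝ × ℝ} (hp : p ≠ ∞) (hf : Param X f)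
    (hg : Param Y g) : ∃ φ : X.carrier ≃ Y.carrier,
      cost p q φ = transportCost p q f g ^ (1 / p.toReal) := by
  obtain ⟨e, he⟩ := hf
  obtain ⟨e', he'⟩ := hg
  refine ⟨e.symm.trans e', ?_⟩
  rw [cost_eq hp, transportCost, transportCost, ← e.tsum_eq]
  simp [he, he']

theorem Param.matchingDist_le {S : Type} {f g : S → ℝ × ℝ} (hp : p ≠ ∞) (hf : Param X f)
    (hg : Param Y g) : matchingDist p q X Y ≤ transportCost p q f g ^ (1 / p.toReal) := by
  obtain ⟨φ, hφ⟩ := hf.exists_cost_eq (q := q) hp hg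
  exact hφ ▸ iInf_le _ φ

theorem transportCost_sum_diagCopies [Fact (1 ≤ q)] (hp : 0 < p.toReal) {S : Type}
    (f g : S → ℝ × ℝ) :
    transportCost p q (Sum.elim f diagCopies) (Sum.elim g diagCopies) = transportCost p q f g := by
  rw [transportCost, Summable.tsum_sum ENNReal.summable ENNReal.summable]
  simp [groundDist_self, transportCost, ENNReal.zero_rpow_of_pos hp]

theorem transportCost_comm [Fact (1 ≤ q)] {S : Type} (f g : S → ℝ × ℝ) :
    transportCost p q f g = transportCost p q g f := by
  simp only [transportCost, groundDist_comm q]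

theorem transportCost_triangle [Fact (1 ≤ q)] (hp : 1 ≤ p.toReal) {S : Type}
    (f g h : S → ℝ × ℝ) :
    transportCost p q f h ^ (1 / p.toReal) ≤
      transportCost p q f g ^ (1 / p.toReal) + transportCost p q g h ^ (1 / p.toReal) := by
  have hp0 : 0 < p.toReal := zero_lt_one.trans_le hp
  rw [one_div, ENNReal.rpow_inv_le_iff hp0, ← one_div, transportCost, ENNReal.tsum_eq_iSup_sum]
  refine iSup_le fun F => ?_
  rw [← ENNReal.rpow_inv_le_iff hp0, ← one_div]
  calc (∑ s ∈ F, groundDist q (f s) (h s) ^ p.toReal) ^ (1 / p.toReal)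
      ≤ (∑ s ∈ F, (groundDist q (f s) (g s) + groundDist q (g s) (h s)) ^ p.toReal)
          ^ (1 / p.toReal) := by
        gcongr with s hs
        exact groundDist_triangle q _ _ _
    _ ≤ _ := ENNReal.Lp_add_le F _ _ hp
    _ ≤ _ := add_le_add (ENNReal.rpow_le_rpow (ENNReal.sum_le_tsum F) (by positivity))
        (ENNReal.rpow_le_rpow (ENNReal.sum_le_tsum F) (by positivity))

theorem cost_trans_le [Fact (1 ≤ q)] (hp : p ≠ ∞) (hp1 : 1 ≤ p.toReal)
    (φ : X.carrier ≃ Y.carrier) (ψ : Y.carrier ≃ Z.carrier) :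
    cost p q (φ.trans ψ) ≤ cost p q φ + cost p q ψ := by
  rw [cost_eq hp, cost_eq hp, cost_eq hp]
  refine (transportCost_triangle hp1 _ (fun x => (φ x).1.1) _).trans_eq ?_
  congr 2
  exact φ.tsum_eq (fun y => groundDist q y.1.1 (ψ y).1.1 ^ p.toReal)

theorem matchingDist_triangle [Fact (1 ≤ q)] (hp : p ≠ ∞) (hp1 : 1 ≤ p.toReal)
    (X Y Z : PersistenceDiagram) :
    matchingDist p q X Z ≤ matchingDist p q X Y + matchingDist p q Y Z := by
  simp only [matchingDist, ENNReal.iInf_add, ENNReal.add_iInf]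
  exact le_iInf fun φ => le_iInf fun ψ => (iInf_le _ _).trans (cost_trans_le hp hp1 _ _)

theorem matchingDist_comm [Fact (1 ≤ q)] (hp : p ≠ ∞) (X Y : PersistenceDiagram) :
    matchingDist p q X Y = matchingDist p q Y X := by
  have key : ∀ X Y : PersistenceDiagram, matchingDist p q X Y ≤ matchingDist p q Y X := by
    refine fun X Y => le_iInf fun φ => ?_
    rw [cost_eq hp, transportCost_comm]
    exact (param_equiv φ).matchingDist_le hp (param_carrier Y)
  exact (key X Y).antisymm (key Y X)

end Distance

/-! ### Existence of optimal bijections -/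

section Optimal

variable {p q : ℝ≥0∞} {X Y : PersistenceDiagram}

theorem transportCost_eq_cost_rpow (hp : p ≠ ∞) (hp0 : 0 < p.toReal) (φ : X.carrier ≃ Y.carrier) :
    transportCost p q (fun x : X.carrier => x.1.1) (fun x => (φ x).1.1) =
      cost p q φ ^ p.toReal := by
  rw [cost_eq hp, ← ENNReal.rpow_mul, one_div, inv_mul_cancel₀ hp0.ne', ENNReal.rpow_one]

/-- A finite-cost matching with the empty diagram moves each such point by at least `δ`, and only
finitely many terms of a convergent sum can be that large. -/
theorem finite_setOf_le_groundDist_diagProj [Fact (1 ≤ q)] (hp : p ≠ ∞) (hp0 : 0 < p.toReal)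
    (hY : Y ∈ Dgm p q) {δ : ℝ≥0∞} (hδ : δ ≠ 0) :
    {y : Y.carrier | δ ≤ groundDist q y.1.1 (diagProj y.1.1)}.Finite := by
  have hY' : matchingDist p q Y empty < ∞ := hY
  obtain ⟨φ, hφ⟩ := iInf_lt_iff.1 hY'
  have h1 : transportCost p q (fun y : Y.carrier => y.1.1) (fun y => (φ y).1.1) ≠ ∞ := by
    rw [transportCost_eq_cost_rpow hp hp0]
    exact (ENNReal.rpow_lt_top_of_nonneg hp0.le hφ.ne).ne
  rcases eq_or_ne δ ∞ with rfl | hδ'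
  · convert Set.finite_empty
    exact Set.eq_empty_of_forall_notMem fun y hy => groundDist_ne_top _ _ _ (top_le_iff.1 hy)
  refine (ENNReal.finite_const_le_of_tsum_ne_top h1 (ε := δ ^ p.toReal)
    (ENNReal.rpow_pos (pos_iff_ne_zero.2 hδ) hδ').ne').subset fun y hy => ?_
  refine ENNReal.rpow_le_rpow (le_trans hy (groundDist_diagProj_le q _ ?_)) hp0.le
  exact (φ y).2.resolve_left fun h => h

theorem groundDist_diagProj_le_add [Fact (1 ≤ q)] (a b : ℝ × ℝ) :
    groundDist q a (diagProj a) ≤ groundDist q a b + groundDist q b (diagProj b) :=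
  (groundDist_diagProj_le q a (b := diagProj b) rfl).trans (groundDist_triangle q _ _ _)

/-- Points of a diagram at finite distance from the empty one that leave every off-diagonal point
approach the diagonal. -/
theorem groundDist_diagProj_le_of_tendsto [Fact (1 ≤ q)] (hp : p ≠ ∞) (hp0 : 0 < p.toReal)
    (hY : Y ∈ Dgm p q) {U : Ultrafilter ℕ} {y : ℕ → Y.carrier}
    (hy : ∀ z ∈ Y.offDiag, ∀ᶠ n in U, (y n).1 ≠ z) {a : ℝ × ℝ} {l : ℝ≥0∞}
    (hl : Filter.Tendsto (fun n => groundDist q a (y n).1.1) U (𝓝 l)) :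
    groundDist q a (diagProj a) ≤ l := by
  have h0 : Filter.Tendsto (fun n => groundDist q (y n).1.1 (diagProj (y n).1.1)) U (𝓝 0) := by
    refine ENNReal.tendsto_nhds_zero.2 fun δ hδ => ?_
    have hfin := finite_setOf_le_groundDist_diagProj hp hp0 hY hδ.ne'
    have hev : ∀ᶠ n in U, ∀ z ∈ {y : Y.carrier | δ ≤ groundDist q y.1.1 (diagProj y.1.1)},
        y n ≠ z := by
      refine (Filter.eventually_all_finite hfin).2 fun z hz => ?_
      rcases z.2 with h | h
      · exact (hy z.1 h).mono fun n hn h' => hn (congrArg Subtype.val h')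
      · have hz0 : groundDist q z.1.1 (diagProj z.1.1) = 0 := by
          rw [← nonpos_iff_eq_zero, ← groundDist_self q z.1.1]
          exact groundDist_diagProj_le q _ h
        rw [Set.mem_ofPred_eq, hz0] at hz
        exact absurd hz hδ.not_ge
    exact hev.mono fun n hn => le_of_not_ge fun h => hn _ h rfl
  have h1 := hl.add h0
  rw [add_zero] at h1
  exact ge_of_tendsto' h1 fun n => groundDist_diagProj_le_add _ _

theorem exists_tendsto_ultrafilter (U : Ultrafilter ℕ) (u : ℕ → ℝ≥0∞) :
    ∃ l, Filter.Tendsto u U (𝓝 l) :=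
  ⟨_, (U.map u).le_nhds_lim⟩

/-- Take the limit of a minimizing sequence along an ultrafilter: an off-diagonal point either has
one partner for almost all `n`, which it keeps, or its partners escape to the diagonal and it is
sent to its projection. A Fatou argument on finite partial sums shows that no cost is gained. -/
theorem exists_isOptimal [Fact (1 ≤ q)] (hp : p ≠ ∞) (hp0 : 0 < p.toReal) (hX : X ∈ Dgm p q)
    (hY : Y ∈ Dgm p q) (hXY : matchingDist p q X Y ≠ ∞) :
    ∃ φ : X.carrier ≃ Y.carrier, IsOptimal p q φ := by
  obtain ⟨φ₀, -⟩ := iInf_lt_iff.1 hXY.lt_top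
  obtain ⟨c, -, hc, hcφ⟩ := exists_seq_tendsto_sInf
    (S := Set.range fun φ : X.carrier ≃ Y.carrier => cost p q φ) ⟨_, φ₀, rfl⟩ (OrderBot.bddBelow _)
  choose φ hφ using hcφ
  obtain rfl : (fun n => cost p q (φ n)) = c := funext hφ
  obtain ⟨U, hU⟩ : ∃ U : Ultrafilter ℕ, (U : Filter ℕ) ≤ Filter.atTop :=
    ⟨Filter.hyperfilter ℕ, Nat.hyperfilter_le_atTop⟩
  replace hc : Filter.Tendsto (fun n => cost p q (φ n)) U (𝓝 (matchingDist p q X Y)) :=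
    hc.mono_left hU
  let iX : X.offDiag → X.carrier := fun x => ⟨x.1, Or.inl x.2⟩
  let iY : Y.offDiag → Y.carrier := fun y => ⟨y.1, Or.inl y.2⟩
  have hg : ∀ x : X.offDiag, ∃ z : (ℝ × ℝ) × ℕ, (z ∈ Y.offDiag ∧ ∀ᶠ n in U, (φ n (iX x)).1 = z) ∨
      ((∀ y ∈ Y.offDiag, ¬ ∀ᶠ n in U, (φ n (iX x)).1 = y) ∧ z = (diagProj x.1.1, 0)) := by
    intro x
    by_cases h : ∃ y ∈ Y.offDiag, ∀ᶠ n in U, (φ n (iX x)).1 = y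
    · exact ⟨h.choose, Or.inl h.choose_spec⟩
    · exact ⟨_, Or.inr ⟨fun y hy hy' => h ⟨y, hy, hy'⟩, rfl⟩⟩
  choose g hg using hg
  have hgoff : ∀ x, (g x).1.1 < (g x).1.2 →
      g x ∈ Y.offDiag ∧ ∀ᶠ n in U, (φ n (iX x)).1 = g x := by
    intro x hx
    rcases hg x with h | h
    · exact h
    · rw [h.2] at hx
      exact absurd hx (lt_irrefl _)
  -- The right summand holds the points of `Y` that are nobody's limit partner; they are matched to
  -- their projections. Index `0` on projections is harmless, since `diagCopies` supplies the
  -- diagonal multiplicities.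
  let S := X.offDiag ⊕ {y : Y.offDiag // ∀ x : X.offDiag, ¬ ∀ᶠ n in U, (φ n (iX x)).1 = y.1}
  let kX : S → (ℝ × ℝ) × ℕ := Sum.elim Subtype.val fun y => (diagProj y.1.1.1, 0)
  let kY : S → (ℝ × ℝ) × ℕ := Sum.elim g fun y => y.1.1
  have iSX : Countable X.offDiag := X.countable_offDiag.to_subtype
  have iSY : Countable Y.offDiag := Y.countable_offDiag.to_subtype
  have iS : Countable S := inferInstanceAs (Countable (_ ⊕ _))
  have hPX : Param X (Sum.elim (fun s => (kX s).1) diagCopies) := by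
    refine param_sum ?_ ?_ ?_ ?_ fun a => Set.to_countable _
    · rintro (x | y)
      · exact (X.above _ x.2).le
      · exact le_rfl
    · rintro (x | y) (x' | y') h1 h2
      · exact congrArg Sum.inl (Subtype.ext h2)
      · rw [h2] at h1
        exact absurd h1 (lt_irrefl _)
      · exact absurd h1 (lt_irrefl _)
      · exact absurd h1 (lt_irrefl _)
    · rintro (x | y) h1
      · exact x.2
      · exact absurd h1 (lt_irrefl _)
    · exact fun z hz => ⟨Sum.inl ⟨z, hz⟩, rfl⟩
  have hPY : Param Y (Sum.elim (fun s => (kY s).1) diagCopies) := by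
    refine param_sum ?_ ?_ ?_ ?_ fun a => Set.to_countable _
    · rintro (x | y)
      · rcases hg x with h | h
        · exact (Y.above _ h.1).le
        · change (g x).1.1 ≤ (g x).1.2
          rw [h.2]
          exact le_rfl
      · exact (Y.above _ y.1.2).le
    · rintro (x | y) (x' | y') h1 h2
      · have h3 := hgoff x h1
        have h4 := hgoff x' (by
          change (kY (Sum.inl x')).1.1 < (kY (Sum.inl x')).1.2; rw [← h2]; exact h1)
        obtain ⟨n, hn, hn'⟩ := (h3.2.and h4.2).exists
        have h5 := (φ n).injective (Subtype.ext (hn.trans (h2.trans hn'.symm)))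
        exact congrArg Sum.inl (Subtype.ext (congrArg (fun z => z.1) h5))
      · exact absurd (((hgoff x h1).2).mono fun n hn => hn.trans h2) (y'.2 x)
      · have h3 := hgoff x' (by
          change (kY (Sum.inl x')).1.1 < (kY (Sum.inl x')).1.2; rw [← h2]; exact h1)
        exact absurd (h3.2.mono fun n hn => hn.trans h2.symm) (y.2 x')
      · exact congrArg Sum.inr (Subtype.ext (Subtype.ext h2))
    · rintro (x | y) h1
      · exact (hgoff x h1).1
      · exact y.1.2
    · intro z hz
      by_cases h : ∃ x : X.offDiag, ∀ᶠ n in U, (φ n (iX x)).1 = z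
      · obtain ⟨x, hx⟩ := h
        refine ⟨Sum.inl x, ?_⟩
        rcases hg x with h | h
        · obtain ⟨n, hn, hn'⟩ := (h.2.and hx).exists
          exact hn.symm.trans hn'
        · exact absurd hx (h.1 z hz)
      · exact ⟨Sum.inr ⟨⟨z, hz⟩, fun x hx => h ⟨x, hx⟩⟩, rfl⟩
  obtain ⟨ψ, hψ⟩ := hPX.exists_cost_eq (q := q) hp hPY
  rw [transportCost_sum_diagCopies hp0] at hψ
  refine ⟨ψ, le_antisymm ?_ (iInf_le _ ψ)⟩
  rw [hψ, one_div, ENNReal.rpow_inv_le_iff hp0, transportCost, ENNReal.tsum_eq_iSup_sum]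
  refine iSup_le fun F => ?_
  -- `ρ n i` is the point of `X` whose cost under `φ n` pays for the pair `i`. On a finite set these
  -- payers are eventually distinct, so no term is charged twice.
  let ρ : ℕ → S → X.carrier := fun n => Sum.elim iX fun y => (φ n).symm (iY y.1)
  have hρ : ∀ᶠ n in U, Set.InjOn (ρ n) F := by
    have key : ∀ i ∈ F, ∀ j ∈ F, ∀ᶠ n in U, ρ n i = ρ n j → i = j := by
      have hmix : ∀ (x : X.offDiag) (y : {y : Y.offDiag //
          ∀ x : X.offDiag, ¬ ∀ᶠ n in U, (φ n (iX x)).1 = y.1}),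
          ∀ᶠ n in U, iX x ≠ (φ n).symm (iY y.1) := fun x y =>
        (Ultrafilter.eventually_not.2 (y.2 x)).mono fun n hn h => hn (by
          rw [h, Equiv.apply_symm_apply])
      rintro (x | y) - (x' | y') -
      · exact .of_forall fun n h => congrArg Sum.inl (Subtype.ext (congrArg (fun z => z.1) h))
      · exact (hmix x y').mono fun n hn h => absurd h hn
      · exact (hmix x' y).mono fun n hn h => absurd h.symm hn
      · refine .of_forall fun n h => congrArg Sum.inr (Subtype.ext (Subtype.ext ?_))
        exact congrArg (fun z => z.1) ((φ n).symm.injective h)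
    refine ((Filter.eventually_all_finset F).2 fun i hi =>
      (Filter.eventually_all_finset F).2 fun j hj => key i hi j hj).mono fun n hn => ?_
    exact fun i hi j hj h => hn i hi j hj h
  have hlim : ∀ i, ∃ l, Filter.Tendsto
      (fun n => groundDist q (ρ n i).1.1 (φ n (ρ n i)).1.1) U (𝓝 l) := fun i =>
    exists_tendsto_ultrafilter U _
  choose l hl using hlim
  have hle : ∀ i, groundDist q (kX i).1 (kY i).1 ≤ l i := by
    rintro (x | y)
    · rcases hg x with h | h
      · refine le_of_eq (tendsto_nhds_unique (tendsto_const_nhds.congr' ?_) (hl (Sum.inl x)))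
        exact h.2.mono fun n hn => by
          change groundDist q x.1.1 (g x).1 = groundDist q x.1.1 (φ n (iX x)).1.1
          rw [hn]
      · change groundDist q x.1.1 (g x).1 ≤ _
        rw [h.2]
        exact groundDist_diagProj_le_of_tendsto hp hp0 hY
          (fun z hz => Ultrafilter.eventually_not.2 (h.1 z hz)) (hl (Sum.inl x))
    · change groundDist q (diagProj y.1.1.1) y.1.1.1 ≤ _
      rw [groundDist_comm]
      refine groundDist_diagProj_le_of_tendsto hp hp0 hX (y := fun n => (φ n).symm (iY y.1))
        (fun z hz => ?_) ((hl (Sum.inr y)).congr fun n => ?_)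
      · refine (Ultrafilter.eventually_not.2 (y.2 ⟨z, hz⟩)).mono fun n hn h => hn ?_
        rw [show iX ⟨z, hz⟩ = (φ n).symm (iY y.1) from Subtype.ext h.symm,
          Equiv.apply_symm_apply]
      · change groundDist q ((φ n).symm (iY y.1)).1.1 (φ n ((φ n).symm (iY y.1))).1.1 = _
        rw [Equiv.apply_symm_apply, groundDist_comm]
  calc ∑ i ∈ F, groundDist q (kX i).1 (kY i).1 ^ p.toReal ≤ ∑ i ∈ F, l i ^ p.toReal :=
        Finset.sum_le_sum fun i _ => ENNReal.rpow_le_rpow (hle i) hp0.le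
    _ ≤ matchingDist p q X Y ^ p.toReal := by
        refine le_of_tendsto_of_tendsto (tendsto_finsetSum F fun i _ =>
          ((ENNReal.continuous_rpow_const (y := p.toReal)).tendsto _).comp (hl i))
          (((ENNReal.continuous_rpow_const (y := p.toReal)).tendsto _).comp hc)
          (hρ.mono fun n hn => ?_)
        simp only [Function.comp_apply]
        rw [← transportCost_eq_cost_rpow hp hp0, transportCost,
          ← Finset.sum_image (g := ρ n) (f := fun x : X.carrier =>
            groundDist q x.1.1 (φ n x).1.1 ^ p.toReal) hn]
        exact ENNReal.sum_le_tsum _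

end Optimal

/-! ### Rigidity of optimal bijections -/

section Rigidity

variable {p q : ℝ≥0∞} [Fact (1 ≤ q)] {W X Y : PersistenceDiagram}

theorem eq_of_groundDist_eq_zero {a b : ℝ × ℝ} (h : groundDist q a b = 0) : a = b := by
  have h1 := norm_le_zero_iff.1 (ENNReal.ofReal_eq_zero.1 h)
  exact sub_eq_zero.1 ((WithLp.toLp_eq_zero q).1 h1)

theorem groundDist_segment (x y : ℝ × ℝ) (s t : ℝ) :
    groundDist q ((1 - s) • x + s • y) ((1 - t) • x + t • y) =
      ENNReal.ofReal |t - s| * groundDist q x y := by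
  rw [groundDist, groundDist, show (1 - s) • x + s • y - ((1 - t) • x + t • y) =
    (t - s) • (x - y) by module, WithLp.toLp_smul, norm_smul, ENNReal.ofReal_mul (norm_nonneg _),
    Real.norm_eq_abs]

/-- In a composition of bijections that realizes the distance in proportion `s : 1 - s`, every
point passes through the corresponding point of its segment. -/
theorem eq_segment_of_cost_le (hp : p ≠ ∞) (hp0 : 0 < p.toReal)
    (hc : StrictConvexOn ℝ Set.univ (fun v : ℝ × ℝ => ‖WithLp.toLp q v‖ ^ p.toReal))
    (hXY : matchingDist p q X Y ≠ ∞) {s : ℝ} (h0 : 0 < s) (h1 : s < 1)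
    (a : X.carrier ≃ W.carrier) (b : W.carrier ≃ Y.carrier)
    (ha : cost p q a ≤ ENNReal.ofReal s * matchingDist p q X Y)
    (hb : cost p q b ≤ ENNReal.ofReal (1 - s) * matchingDist p q X Y) (x : X.carrier) :
    (a x).1.1 = (1 - s) • x.1.1 + s • (b (a x)).1.1 := by
  by_contra hx
  have h1' : 0 < 1 - s := sub_pos.2 h1
  set D := matchingDist p q X Y
  -- The weight `c^(1-p)` turns `(cD)^p` into `c D^p`, so the bounds for the two legs sum to `D^p`.
  have hscale : ∀ {c : ℝ} {A : ℝ≥0∞}, 0 < c → A ≤ ENNReal.ofReal c * D →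
      ENNReal.ofReal (c * c⁻¹ ^ p.toReal) * A ^ p.toReal ≤ ENNReal.ofReal c * D ^ p.toReal := by
    intro c A hc hA
    calc _ ≤ ENNReal.ofReal (c * c⁻¹ ^ p.toReal) * (ENNReal.ofReal c * D) ^ p.toReal := by gcongr
      _ = _ := by
        rw [ENNReal.mul_rpow_of_nonneg _ _ hp0.le, ENNReal.ofReal_rpow_of_pos hc, ← mul_assoc,
          ← ENNReal.ofReal_mul (by positivity), mul_assoc, Real.inv_rpow hc.le,
          inv_mul_cancel₀ (by positivity), mul_one]
  have hG : ∑' x : X.carrier, (ENNReal.ofReal (s * s⁻¹ ^ p.toReal) *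
      groundDist q x.1.1 (a x).1.1 ^ p.toReal + ENNReal.ofReal ((1 - s) * (1 - s)⁻¹ ^ p.toReal) *
      groundDist q (a x).1.1 (b (a x)).1.1 ^ p.toReal) ≤ D ^ p.toReal := by
    rw [ENNReal.tsum_add, ENNReal.tsum_mul_left, ENNReal.tsum_mul_left,
      a.tsum_eq (fun w => groundDist q w.1.1 (b w).1.1 ^ p.toReal)]
    have e1 := transportCost_eq_cost_rpow (q := q) hp hp0 a
    have e2 := transportCost_eq_cost_rpow (q := q) hp hp0 b
    rw [transportCost] at e1 e2
    rw [e1, e2]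
    refine (add_le_add (hscale h0 ha) (hscale h1' hb)).trans_eq ?_
    rw [← add_mul, ← ENNReal.ofReal_add h0.le h1'.le]
    simp
  have hD : D ^ p.toReal ≠ ∞ := ENNReal.rpow_ne_top_of_nonneg hp0.le hXY
  have hle : ∀ x : X.carrier, _ := fun x : X.carrier => groundDist_rpow_le_of_convexOn hp0.le
    hc.convexOn h0 h1 x.1.1 (a x).1.1 (b (a x)).1.1
  have hlt := (ENNReal.tsum_lt_tsum (((ENNReal.tsum_le_tsum hle).trans hG).trans_lt
    hD.lt_top).ne hle (groundDist_rpow_lt_of_strictConvexOn hp0.le hc h0 h1 hx)).trans_le hG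
  have e3 := transportCost_eq_cost_rpow (q := q) hp hp0 (a.trans b)
  rw [transportCost] at e3
  refine hlt.not_ge ?_
  simp only [Equiv.trans_apply] at e3
  rw [e3]
  exact ENNReal.rpow_le_rpow (iInf_le _ _) hp0.le

/-- The segments of an optimal bijection do not meet at an interior time, unless they start at the
same point of the plane. -/
theorem IsOptimal.eq_of_segment_eq (hp : p ≠ ∞) (hp0 : 0 < p.toReal)
    (hc : StrictConvexOn ℝ Set.univ (fun v : ℝ × ℝ => ‖WithLp.toLp q v‖ ^ p.toReal))
    (hXY : matchingDist p q X Y ≠ ∞) {φ : X.carrier ≃ Y.carrier} (hφ : IsOptimal p q φ)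
    {t : ℝ} (h0 : 0 < t) (h1 : t < 1) {x x' : X.carrier}
    (h : (1 - t) • x.1.1 + t • (φ x).1.1 = (1 - t) • x'.1.1 + t • (φ x').1.1) :
    x.1.1 = x'.1.1 := by
  classical
  by_contra hx
  have hxx' : x ≠ x' := fun h => hx (h ▸ rfl)
  have hlt := groundDist_rpow_swap_lt (q := q) hp0.le hc h0 h1 hx h
  -- Exchanging the partners of `x` and `x'` alters only two terms; the remaining sum is finite and
  -- cancels, contradicting optimality.
  let ψ := (Equiv.swap x x').trans φ
  let f : X.carrier → ℝ≥0∞ := fun z => groundDist q z.1.1 (φ z).1.1 ^ p.toReal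
  let g : X.carrier → ℝ≥0∞ := fun z => groundDist q z.1.1 (ψ z).1.1 ^ p.toReal
  have hf : ∑' z, f z = matchingDist p q X Y ^ p.toReal := by
    rw [← show cost p q φ = _ from hφ]
    exact transportCost_eq_cost_rpow hp hp0 φ
  have hg : matchingDist p q X Y ^ p.toReal ≤ ∑' z, g z := by
    refine (ENNReal.rpow_le_rpow (iInf_le _ ψ) hp0.le).trans_eq ?_
    exact (transportCost_eq_cost_rpow hp hp0 ψ).symm
  have hsplit : ∀ u : X.carrier → ℝ≥0∞, ∑' z, u z =
      u x + u x' + ∑' z : ((({x, x'} : Finset X.carrier) : Set X.carrier)ᶜ : Set _), u z := by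
    intro u
    rw [← ENNReal.sum_add_tsum_compl {x, x'} u, Finset.sum_pair hxx']
  have hrest : ∑' z : ((({x, x'} : Finset X.carrier) : Set X.carrier)ᶜ : Set _), g z =
      ∑' z : ((({x, x'} : Finset X.carrier) : Set X.carrier)ᶜ : Set _), f z := by
    refine tsum_congr fun z => ?_
    have hz := z.2
    simp only [Finset.coe_insert, Finset.coe_singleton, Set.mem_compl_iff, Set.mem_insert_iff,
      Set.mem_singleton_iff, not_or] at hz
    simp only [g, f, ψ, Equiv.trans_apply, Equiv.swap_apply_of_ne_of_ne hz.1 hz.2]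
  rw [← hf, hsplit f, hsplit g, hrest] at hg
  have hfin : ∑' z : ((({x, x'} : Finset X.carrier) : Set X.carrier)ᶜ : Set _), f z ≠ ∞ := by
    refine ne_top_of_le_ne_top (ENNReal.rpow_ne_top_of_nonneg hp0.le hXY) ?_
    rw [← hf, hsplit f]
    exact le_add_self
  refine hlt.not_ge ?_
  have h3 := (ENNReal.add_le_add_iff_right hfin).1 hg
  simpa [f, g, ψ] using h3

/-! ### Convex combinations along optimal bijections -/

theorem segment_le (φ : X.carrier ≃ Y.carrier) (t : I) (x : X.carrier) :
    ((1 - (t : ℝ)) • x.1.1 + (t : ℝ) • (φ x).1.1).1 ≤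
      ((1 - (t : ℝ)) • x.1.1 + (t : ℝ) • (φ x).1.1).2 := by
  have h1 := mul_le_mul_of_nonneg_left (carrier_le x) (sub_nonneg.2 t.2.2)
  have h2 := mul_le_mul_of_nonneg_left (carrier_le (φ x)) t.2.1
  simpa using add_le_add h1 h2

theorem convexCombination_one (φ : X.carrier ≃ Y.carrier) : convexCombination φ 1 = Y :=
  if_pos rfl

theorem convexCombination_zero (φ : X.carrier ≃ Y.carrier) : convexCombination φ 0 = X := by
  rw [convexCombination, if_neg zero_ne_one]
  ext z
  simp only [interpolant]
  constructor
  · rintro ⟨hz, x, rfl⟩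
    simp only [Set.Icc.coe_zero, sub_zero, one_smul, zero_smul, add_zero] at hz ⊢
    exact mem_offDiag_of_lt x.2 hz
  · exact fun hz => ⟨X.above z hz, ⟨z, Or.inl hz⟩, by simp⟩

/-- Before time `1`, two segments at the same place with the same index start at the same planar
point with that index, so they coincide: no multiplicity is lost by inheriting the indices of `X`.
-/
theorem IsOptimal.param_convexCombination (hp : p ≠ ∞) (hp0 : 0 < p.toReal)
    (hc : StrictConvexOn ℝ Set.univ (fun v : ℝ × ℝ => ‖WithLp.toLp q v‖ ^ p.toReal))
    (hXY : matchingDist p q X Y ≠ ∞) {φ : X.carrier ≃ Y.carrier} (hφ : IsOptimal p q φ) (t : I) :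
    Param (convexCombination φ t) (Sum.elim (fun x : X.carrier =>
      (1 - (t : ℝ)) • x.1.1 + (t : ℝ) • (φ x).1.1) diagCopies) := by
  by_cases ht : t = 1
  · subst ht
    rw [convexCombination_one]
    simpa using (param_equiv φ).sum_diagCopies
  have ht1 : (t : ℝ) < 1 := unitInterval.lt_one_iff_ne_one.2 ht
  refine param_sum (k := fun x : X.carrier =>
    ((1 - (t : ℝ)) • x.1.1 + (t : ℝ) • (φ x).1.1, x.1.2)) (segment_le φ t) ?_ ?_ ?_ ?_
  · intro x x' _ h
    have h1 := (Prod.ext_iff.1 h).1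
    have h2 : x.1.2 = x'.1.2 := (Prod.ext_iff.1 h).2
    refine Subtype.ext (Prod.ext ?_ h2)
    rcases eq_or_ne t 0 with rfl | ht0
    · simpa using h1
    · exact hφ.eq_of_segment_eq hp hp0 hc hXY (unitInterval.pos_iff_ne_zero.2 ht0) ht1 h1
  · intro x hx
    rw [convexCombination, if_neg ht]
    exact ⟨hx, x, rfl⟩
  · intro z hz
    rw [convexCombination, if_neg ht] at hz
    obtain ⟨-, x, hx⟩ := hz
    exact ⟨x, hx.symm⟩
  -- Finite cost leaves only countably many moving points; a stationary point found at `(a, a)` is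
  -- one of the copies of `(a, a)`.
  · intro a
    have hfin : ∑' x : X.carrier, groundDist q x.1.1 (φ x).1.1 ^ p.toReal ≠ ∞ := by
      have e := transportCost_eq_cost_rpow (q := q) hp hp0 φ
      rw [transportCost] at e
      rw [e, show cost p q φ = _ from hφ]
      exact ENNReal.rpow_ne_top_of_nonneg hp0.le hXY
    refine ((Summable.countable_support_ennreal hfin).union
      (countable_setOf_carrier_eq X (a, a))).mono fun x hx => ?_
    by_cases h : groundDist q x.1.1 (φ x).1.1 ^ p.toReal = 0
    · right
      have h1 := eq_of_groundDist_eq_zero ((ENNReal.rpow_eq_zero_iff_of_pos hp0).1 h)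
      simp only [Set.mem_ofPred_eq] at hx ⊢
      rw [← hx, ← h1]
      module
    · exact Or.inl h

theorem IsOptimal.matchingDist_convexCombination_le (hp : p ≠ ∞) (hp0 : 0 < p.toReal)
    (hc : StrictConvexOn ℝ Set.univ (fun v : ℝ × ℝ => ‖WithLp.toLp q v‖ ^ p.toReal))
    (hXY : matchingDist p q X Y ≠ ∞) {φ : X.carrier ≃ Y.carrier} (hφ : IsOptimal p q φ)
    (s t : I) : matchingDist p q (convexCombination φ s) (convexCombination φ t) ≤
      ENNReal.ofReal |(t : ℝ) - s| * matchingDist p q X Y := by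
  refine ((hφ.param_convexCombination hp hp0 hc hXY s).matchingDist_le hp
    (hφ.param_convexCombination hp hp0 hc hXY t)).trans ?_
  rw [transportCost_sum_diagCopies hp0, one_div, ENNReal.rpow_inv_le_iff hp0, transportCost]
  simp only [groundDist_segment, ENNReal.mul_rpow_of_nonneg _ _ hp0.le]
  have e := transportCost_eq_cost_rpow (q := q) hp hp0 φ
  rw [transportCost] at e
  rw [ENNReal.tsum_mul_left, e, show cost p q φ = _ from hφ]

end Rigidity

/-! ### Convex combinations are geodesics, and every geodesic is one up to distance zero -/

section Geodesic

variable {p q : ℝ≥0∞} [Fact (1 ≤ q)] {X Y : PersistenceDiagram}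

theorem matchingDist_self (hp : p ≠ ∞) (hp0 : 0 < p.toReal) (X : PersistenceDiagram) :
    matchingDist p q X X = 0 := by
  refine le_antisymm (((param_carrier X).matchingDist_le hp (param_carrier X)).trans_eq ?_) zero_le
  simp [transportCost, groundDist_self, ENNReal.zero_rpow_of_pos hp0, hp0]

theorem matchingDist_lt_top_of_mem (hp : p ≠ ∞) (hp1 : 1 ≤ p.toReal) (hX : X ∈ Dgm p q)
    (hY : Y ∈ Dgm p q) : matchingDist p q X Y < ∞ := by
  refine (matchingDist_triangle hp hp1 X empty Y).trans_lt (ENNReal.add_lt_top.2 ⟨hX, ?_⟩)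
  rw [matchingDist_comm hp]
  exact hY

theorem mem_Dgm_of_matchingDist_lt_top (hp : p ≠ ∞) (hp1 : 1 ≤ p.toReal) (hX : X ∈ Dgm p q)
    (h : matchingDist p q Y X < ∞) : Y ∈ Dgm p q :=
  (matchingDist_triangle hp hp1 Y X empty).trans_lt (ENNReal.add_lt_top.2 ⟨h, hX⟩)

/-- The upper bounds on `[0,s]`, `[s,t]` and `[t,1]` add up to exactly `D`, so the triangle
inequality leaves no slack in any of them. -/
theorem IsOptimal.matchingDist_convexCombination_eq (hp : p ≠ ∞) (hp1 : 1 ≤ p.toReal)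
    (hc : StrictConvexOn ℝ Set.univ (fun v : ℝ × ℝ => ‖WithLp.toLp q v‖ ^ p.toReal))
    (hXY : matchingDist p q X Y ≠ ∞) {φ : X.carrier ≃ Y.carrier} (hφ : IsOptimal p q φ)
    (s t : I) : matchingDist p q (convexCombination φ s) (convexCombination φ t) =
      ENNReal.ofReal |(t : ℝ) - s| * matchingDist p q X Y := by
  wlog hst : s ≤ t generalizing s t
  · rw [matchingDist_comm hp, this t s (le_of_not_ge hst), abs_sub_comm]
  have hp0 : 0 < p.toReal := zero_lt_one.trans_le hp1
  have hle := hφ.matchingDist_convexCombination_le hp hp0 hc hXY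
  refine le_antisymm (hle s t) ?_
  have h1 := hle 0 s
  have h2 := hle t 1
  rw [convexCombination_zero] at h1
  rw [convexCombination_one] at h2
  have h3 := (matchingDist_triangle hp hp1 X (convexCombination φ s) Y).trans
    (add_le_add h1 ((matchingDist_triangle hp hp1 _ (convexCombination φ t) Y).trans
      (add_le_add_right h2 _)))
  have hst' : (s : ℝ) ≤ t := hst
  have hs := s.2.1
  have ht := t.2.2
  simp only [Set.Icc.coe_zero, Set.Icc.coe_one, sub_zero, abs_of_nonneg hs,
    abs_of_nonneg (sub_nonneg.2 ht)] at h3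
  rw [abs_of_nonneg (sub_nonneg.2 hst')]
  set D := matchingDist p q X Y
  have e : D = ENNReal.ofReal s * D + (ENNReal.ofReal (t - s) * D + ENNReal.ofReal (1 - t) * D) := by
    rw [← add_mul, ← add_mul, ← ENNReal.ofReal_add (by linarith) (by linarith),
      ← ENNReal.ofReal_add hs (by linarith)]
    simp
  have hfin : ∀ c : ℝ, ENNReal.ofReal c * D ≠ ∞ := fun c =>
    ENNReal.mul_ne_top ENNReal.ofReal_ne_top hXY
  exact (ENNReal.add_le_add_iff_right (hfin _)).1
    ((ENNReal.add_le_add_iff_left (hfin _)).1 (e.symm.trans_le h3))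

theorem IsOptimal.exists_isConvexCombinationGeodesic (hp : p ≠ ∞) (hp1 : 1 ≤ p.toReal)
    (hc : StrictConvexOn ℝ Set.univ (fun v : ℝ × ℝ => ‖WithLp.toLp q v‖ ^ p.toReal))
    (hX : X ∈ Dgm p q) (hY : Y ∈ Dgm p q) {φ : X.carrier ≃ Y.carrier} (hφ : IsOptimal p q φ) :
    ∃ γ : I → Dgm p q, IsConvexCombinationGeodesic p q X Y γ ∧
      ∀ t, (γ t : PersistenceDiagram) = convexCombination φ t := by
  have hXY := (matchingDist_lt_top_of_mem hp hp1 hX hY).ne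
  have heq := hφ.matchingDist_convexCombination_eq hp hp1 hc hXY
  have hmem : ∀ t, convexCombination φ t ∈ Dgm p q := fun t => by
    refine mem_Dgm_of_matchingDist_lt_top hp hp1 hX ?_
    have h := heq t 0
    rw [convexCombination_zero] at h
    rw [h]
    exact ENNReal.mul_lt_top ENNReal.ofReal_lt_top hXY.lt_top
  refine ⟨fun t => ⟨convexCombination φ t, hmem t⟩, ⟨⟨convexCombination_zero φ,
    convexCombination_one φ, fun t => ?_, fun s t => ?_⟩, φ, hφ, fun _ => rfl⟩, fun _ => rfl⟩
  · simp only [heq]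
    have h1 : Continuous fun s : I => ENNReal.ofReal |(t : ℝ) - s| * matchingDist p q X Y :=
      (ENNReal.continuous_mul_const hXY).comp (ENNReal.continuous_ofReal.comp (by fun_prop))
    simpa using h1.tendsto t
  · simp only [heq s t, convexCombination_zero, convexCombination_one]

/-- In a space of diagrams whose ground cost is strictly convex, every geodesic is, up to distance
zero, the convex combination along an optimal bijection. -/
theorem IsGeodesic.exists_convexCombination (hp : p ≠ ∞) (hp1 : 1 ≤ p.toReal)
    (hc : StrictConvexOn ℝ Set.univ (fun v : ℝ × ℝ => ‖WithLp.toLp q v‖ ^ p.toReal))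
    (hX : X ∈ Dgm p q) (hY : Y ∈ Dgm p q) {μ : I → Dgm p q} (hμ : IsGeodesic p q X Y μ) :
    ∃ φ : X.carrier ≃ Y.carrier, IsOptimal p q φ ∧
      ∀ t, matchingDist p q (convexCombination φ t) (μ t) = 0 := by
  have hp0 : 0 < p.toReal := zero_lt_one.trans_le hp1
  have hXY := (matchingDist_lt_top_of_mem hp hp1 hX hY).ne
  have hopt : ∀ s t : I, s ≤ t → ∃ φ : (μ s : PersistenceDiagram).carrier ≃
      (μ t : PersistenceDiagram).carrier,
      cost p q φ ≤ ENNReal.ofReal (t - s) * matchingDist p q X Y := by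
    intro s t hst
    obtain ⟨φ, hφ⟩ := exists_isOptimal hp hp0 (μ s).2 (μ t).2
      (matchingDist_lt_top_of_mem hp hp1 (μ s).2 (μ t).2).ne
    refine ⟨φ, le_of_eq ?_⟩
    rw [show cost p q φ = _ from hφ, hμ.dist_eq, hμ.source, hμ.target,
      abs_of_nonneg (sub_nonneg.2 (show (s : ℝ) ≤ t from hst))]
  have hadd : ∀ {A B C : PersistenceDiagram} (φ : A.carrier ≃ B.carrier) (ψ : B.carrier ≃ C.carrier)
      {c d : ℝ}, 0 ≤ c → 0 ≤ d → cost p q φ ≤ ENNReal.ofReal c * matchingDist p q X Y →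
      cost p q ψ ≤ ENNReal.ofReal d * matchingDist p q X Y →
      cost p q (φ.trans ψ) ≤ ENNReal.ofReal (c + d) * matchingDist p q X Y := by
    intro A B C φ ψ c d h0 h1 h2 h3
    rw [ENNReal.ofReal_add h0 h1, add_mul]
    exact (cost_trans_le hp hp1 φ ψ).trans (add_le_add h2 h3)
  have hXm := hμ.source
  have hYm := hμ.target
  have hopt0 : ∀ t : I, ∃ φ : X.carrier ≃ (μ t : PersistenceDiagram).carrier,
      cost p q φ ≤ ENNReal.ofReal t * matchingDist p q X Y := by
    intro t
    have h := hopt 0 t t.2.1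
    rw [hXm] at h
    simpa using h
  have hopt1 : ∀ t : I, ∃ φ : (μ t : PersistenceDiagram).carrier ≃ Y.carrier,
      cost p q φ ≤ ENNReal.ofReal (1 - t) * matchingDist p q X Y := by
    intro t
    have h := hopt t 1 t.2.2
    rw [hYm] at h
    simpa using h
  -- The reference time at which `φ` is built; the argument uses only that it is interior.
  let m : I := ⟨1 / 2, by norm_num, by norm_num⟩
  have hm : (m : ℝ) = 1 / 2 := rfl
  have hm0 : 0 < (m : ℝ) := by norm_num [hm]
  have hm1 : (m : ℝ) < 1 := by norm_num [hm]
  obtain ⟨ψ, hψ⟩ := hopt0 m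
  obtain ⟨χ, hχ⟩ := hopt1 m
  have hmid := eq_segment_of_cost_le hp hp0 hc hXY hm0 hm1 ψ χ hψ hχ
  have hφ : IsOptimal p q (ψ.trans χ) := by
    refine le_antisymm ?_ (iInf_le _ _)
    simpa using hadd ψ χ hm0.le (sub_nonneg.2 hm1.le) hψ hχ
  refine ⟨ψ.trans χ, hφ, fun t => ?_⟩
  rcases eq_or_ne t 0 with rfl | ht0
  · rw [convexCombination_zero, hXm]
    exact matchingDist_self hp hp0 X
  rcases eq_or_ne t 1 with rfl | ht1
  · rw [convexCombination_one, hYm]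
    exact matchingDist_self hp hp0 Y
  have h0 : 0 < (t : ℝ) := unitInterval.pos_iff_ne_zero.2 ht0
  have h1 : (t : ℝ) < 1 := unitInterval.lt_one_iff_ne_one.2 ht1
  suffices h : Param (μ t : PersistenceDiagram) fun x : X.carrier =>
      (1 - (t : ℝ)) • x.1.1 + (t : ℝ) • (χ (ψ x)).1.1 by
    refine le_antisymm (((hφ.param_convexCombination hp hp0 hc hXY t).matchingDist_le hp
      h.sum_diagCopies).trans_eq ?_) zero_le
    simp [transportCost, groundDist_self, ENNReal.zero_rpow_of_pos hp0, hp0]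
  rcases le_total t m with htm | htm
  · have htm' : (t : ℝ) ≤ m := htm
    obtain ⟨a, ha⟩ := hopt0 t
    obtain ⟨b, hb⟩ := hopt t m htm
    have hab := hadd a b h0.le (sub_nonneg.2 htm') ha hb
    have hbχ := hadd b χ (sub_nonneg.2 htm') (sub_nonneg.2 hm1.le) hb hχ
    rw [add_sub_cancel] at hab
    rw [sub_add_sub_cancel'] at hbχ
    have h2 := eq_segment_of_cost_le hp hp0 hc hXY hm0 hm1 (a.trans b) χ hab hχ
    have h3 := eq_segment_of_cost_le hp hp0 hc hXY h0 h1 a (b.trans χ) ha hbχ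
    -- The path through `a` and `b` reaching `ψ x` may start at another point than `x`. Both
    -- segments have midpoint `ψ x` and end `χ (ψ x)`, so the two starts agree in the plane.
    refine ⟨ψ.trans b.symm, fun x => ?_⟩
    have h4 := h2 ((a.trans b).symm (ψ x))
    have h5 := h3 ((a.trans b).symm (ψ x))
    simp only [Equiv.apply_symm_apply] at h4
    simp only [Equiv.trans_apply, Equiv.symm_trans_apply, Equiv.apply_symm_apply] at h4 h5 ⊢
    rw [hmid x] at h4
    have h6 := smul_right_injective _ (sub_pos.2 hm1).ne' (add_right_cancel h4)
    rw [h5, ← h6]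
  · have htm' : (m : ℝ) ≤ t := htm
    obtain ⟨a, ha⟩ := hopt m t htm
    obtain ⟨b, hb⟩ := hopt1 t
    have hab := hadd a b (sub_nonneg.2 htm') (sub_nonneg.2 h1.le) ha hb
    have hψa := hadd ψ a hm0.le (sub_nonneg.2 htm') hψ ha
    rw [sub_add_sub_cancel'] at hab
    rw [add_sub_cancel] at hψa
    have h2 := eq_segment_of_cost_le hp hp0 hc hXY hm0 hm1 ψ (a.trans b) hψ hab
    have h3 := eq_segment_of_cost_le hp hp0 hc hXY h0 h1 (ψ.trans a) b hψa hb
    -- Here the segments share the start `x` and the midpoint `ψ x`, so their ends agree in the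
    -- plane.
    refine ⟨ψ.trans a, fun x => ?_⟩
    have h4 := (hmid x).symm.trans (h2 x)
    have h6 := smul_right_injective _ hm0.ne' (add_left_cancel h4)
    simp only [Equiv.trans_apply] at h6 h3 ⊢
    rw [h3 x, h6]

end Geodesic

end PersistenceDiagram

theorem theorem4 (p q : ENNReal)
    (hpq : (p = q ∧ 2 ≤ p ∧ p < ⊤) ∨ (q = 2 ∧ 1 < p ∧ p < ⊤))
    (X Y : PersistenceDiagram)
    (hX : X ∈ PersistenceDiagram.Dgm p q) (hY : Y ∈ PersistenceDiagram.Dgm p q)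
    (μ : unitInterval → PersistenceDiagram.Dgm p q)
    (hμ : PersistenceDiagram.IsGeodesic p q X Y μ) :
    ∃ γ : unitInterval → PersistenceDiagram.Dgm p q,
      PersistenceDiagram.IsConvexCombinationGeodesic p q X Y γ ∧
        ∀ t : unitInterval, PersistenceDiagram.matchingDist p q (γ t) (μ t) = 0 := by
  have hp : p ≠ ∞ := by
    rcases hpq with h | h
    exacts [h.2.2.ne, h.2.2.ne]
  have h1p : 1 < p := by
    rcases hpq with h | h
    exacts [ENNReal.one_lt_two.trans_le h.2.1, h.2.1]
  have hp1 : 1 < p.toReal := (ENNReal.toReal_one ▸ ENNReal.toReal_lt_toReal ENNReal.one_ne_top hp).2 h1p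
  have hq : Fact (1 ≤ q) := by
    refine ⟨?_⟩
    rcases hpq with h | h
    · exact h.1 ▸ h1p.le
    · exact h.1 ▸ ENNReal.one_lt_two.le
  have hc : StrictConvexOn ℝ Set.univ (fun v : ℝ × ℝ => ‖WithLp.toLp q v‖ ^ p.toReal) := by
    rcases hpq with ⟨rfl, -⟩ | ⟨rfl, -⟩
    · exact PersistenceDiagram.strictConvexOn_norm_toLp_self hp1
    · exact PersistenceDiagram.strictConvexOn_norm_toLp_two hp1
  obtain ⟨φ, hφ, hφμ⟩ := hμ.exists_convexCombination hp hp1.le hc hX hY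
  obtain ⟨γ, hγ, hγφ⟩ := hφ.exists_isConvexCombinationGeodesic hp hp1.le hc hX hY
  exact ⟨γ, hγ, fun t => hγφ t ▸ hφμ t⟩
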